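/- Let $m$ be Lebesgue measure on $[0,1]$. Let $r_k(t)=\operatorname{sign}\sin(2^k\pi t)$, $k\ge 1$, be the Rademacher functions, and let $(w_n)_{n\ge 0}$ be the Walsh system in Paley's numbering: $w_n=\prod_{i\in I} r_{i+1}$ where $n=\sum_{i\in I}2^i$ with $I\subset\{0,1,2,\dots\}$ finite (so $w_0=1$). For $q>1$, a sequence $(w_{n_k})_{k\ge1}$ with positive integers $n_k$ is called $q$-lacunary if $n_{k+1}/n_k\ge q$ for all $k\ge 1$. Let $M_2(t)=\exp(t^2)-1$ and, for measurable $f$ on $[0,1]$, let $\|f\|_{L^{M_2}}=\inf\{\lambda>0:\int_0^1 M_2(|f|/\lambda)\,dm\le 1\}$ (with value $\infty$ if there is no such $\lambda$). For a measurable set $E\subset[0,1]$ with $m(E)>0$ put $\rho_E(x)=m(E\cap[0,x])/m(E)$, let $\rho_E^{-1}(t)=\inf\{x\in[0,1]:\rho_E(x)\ge t\}$ be its left-continuous inverse, and let $\|f\|_{L^{M_2}|E}=\|f\circ\rho_E^{-1}\|_{L^{M_2}}$. For every $q>1$ there exist constants $A'=A'(M_2,q)>0$ and $B'=B'(M_2,q)>0$,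 depending only on $q$, such that for every measurable set $E\subset[0,1]$ with $m(E)>0$ there is an $N$ (depending on $E$ and $q$) such that for every $q$-lacunary sequence $(w_{n_k})_{k\ge1}$ of Walsh functions with $n_k\ge N$ for all $k\ge1$ and every real sequence $(a_k)_{k\ge1}\in\ell^2$, the series $\sum_{k\ge1}a_kw_{n_k}$ converges unconditionally in $L^2([0,1])$ and its sum satisfies $$A'\Big(\sum_{k=1}^\infty a_k^2\Big)^{1/2}\le\Big\|\sum_{k\ge1}a_kw_{n_k}\Big\|_{L^{M_2}|E}\le B'\Big(\sum_{k=1}^\infty a_k^2\Big)^{1/2}.$$ -/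

import Mathlib

open MeasureTheory
open scoped ENNReal

noncomputable section

/-- The Rademacher function `r_k(t) = sign (sin (2^k π t))`, used for `k ≥ 1`, `t ∈ [0,1]`. -/
def rademacher (k : ℕ) (t : ℝ) : ℝ := Real.sign (Real.sin (2 ^ k * Real.pi * t))

/-- The `k`-th Walsh function in Paley's numbering: if `k = ∑ 2^i` over the positions `i` of the
binary digits `1` of `k`, then `w_k = ∏ r_{i+1}` over the same `i`; in particular `w_0 = 1`. -/
def walsh (k : ℕ) (t : ℝ) : ℝ := ∏ i ∈ k.bitIndices.toFinset, rademacher (i + 1) t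

/-- Lebesgue measure on `[0,1]`. -/
def unitMeasure : Measure ℝ := volume.restrict (Set.Icc 0 1)

lemma measurable_rademacher (k : ℕ) : Measurable (rademacher k) := by
  have hs : Measurable Real.sign := by
    unfold Real.sign
    exact Measurable.ite measurableSet_Iio measurable_const
      (Measurable.ite measurableSet_Ioi measurable_const measurable_const)
  exact hs.comp (by fun_prop)

lemma measurable_walsh (k : ℕ) : Measurable (walsh k) := by
  unfold walsh
  exact Finset.measurable_fun_prod _ fun i _ => measurable_rademacher (i + 1)

lemma abs_rademacher_le_one (k : ℕ) (t : ℝ) : |rademacher k t| ≤ 1 := by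
  unfold rademacher
  rcases Real.sign_apply_eq (Real.sin (2 ^ k * Real.pi * t)) with h | h | h <;> simp [h]

lemma abs_walsh_le_one (k : ℕ) (t : ℝ) : |walsh k t| ≤ 1 := by
  unfold walsh
  rw [Finset.abs_prod]
  exact Finset.prod_le_one (fun _ _ => abs_nonneg _) fun i _ => abs_rademacher_le_one (i + 1) t

lemma memLp_walsh (k : ℕ) : MemLp (walsh k) 2 unitMeasure := by
  have : IsFiniteMeasure unitMeasure := by unfold unitMeasure; infer_instance
  exact MemLp.of_bound (measurable_walsh k).aestronglyMeasurable 1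
    (Filter.Eventually.of_forall fun t => abs_walsh_le_one k t)

/-- The Walsh function `w_k` as an element of `L²([0,1])`. -/
def walshLp (k : ℕ) : Lp ℝ 2 unitMeasure := (memLp_walsh k).toLp (walsh k)

/-- The sequence `(w_{n_k})` of Walsh functions is `q`-lacunary: the indices are positive and
`n_{k+1} / n_k ≥ q` for all `k`. -/
def IsLacunary (q : ℝ) (n : ℕ → ℕ) : Prop :=
  ∀ k, 0 < n k ∧ q ≤ (n (k + 1) : ℝ) / (n k : ℝ)

/-- The Luxemburg norm
`‖f‖_{L^Φ} = inf {c > 0 : ∫_0^1 Φ(|f|/c) dm ≤ 1}` of a measurable function on `[0,1]`.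
It takes values in `[0,∞]`, and is `∞` (the infimum of the empty set) exactly when the measurable
function `f` does not belong to the Orlicz space `L^Φ`. -/
def orliczNorm (Φ : ℝ → ℝ) (f : ℝ → ℝ) : ℝ≥0∞ :=
  ⨅ (c : ℝ) (_ : 0 < c ∧ ∫⁻ t, ENNReal.ofReal (Φ (|f t| / c)) ∂unitMeasure ≤ 1), ENNReal.ofReal c

/-- The Young function `M₂(t) = exp(t²) - 1`. -/
def youngM2 (t : ℝ) : ℝ := Real.exp (t ^ 2) - 1

/-- The map `ρ_E(x) = m(E ∩ [0,x]) / m(E)`. -/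
def rhoE (E : Set ℝ) (x : ℝ) : ℝ := volume.real (E ∩ Set.Icc 0 x) / volume.real E

/-- The left-continuous inverse `ρ_E⁻¹(t) = inf {x ∈ [0,1] : ρ_E(x) ≥ t}` of the increasing
function `ρ_E`, for `t ∈ [0,1]`. -/
def rhoEInv (E : Set ℝ) (t : ℝ) : ℝ := sInf {x | x ∈ Set.Icc (0 : ℝ) 1 ∧ t ≤ rhoE E x}

/-- The norm `‖f‖_{X|E} = ‖f ∘ ρ_E⁻¹‖_X` of the local space `X|E`, where `X` is given by its norm
(with value `∞` outside `X`). Since `ρ_E⁻¹(t) ∈ E` for almost every `t`, only the values of `f`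
on `E` matter. -/
def localNorm (X : (ℝ → ℝ) → ℝ≥0∞) (E : Set ℝ) (f : ℝ → ℝ) : ℝ≥0∞ := X (f ∘ rhoEInv E)

end

/-!
The product of the Walsh functions `w_m` and `w_n` is `w_{m xor n}`, so integrals over `E` of
products of the `w_{n_k}` are Walsh coefficients of the indicator function of `E`. By Bessel's
inequality the coefficients at frequencies at least `L` have small square sum once `L` is large;
a large `N` pushes every nonzero frequency that occurs beyond `L`.

For the lower bound, expand `∫_E (∑ a_k w_{n_k})²`. In the off-diagonal part the frequency
`n_j xor n_k`, `j < k`, is comparable with `n_k`, and each frequency occurs a bounded number of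
times, so by Cauchy-Schwarz this part is negligible against the diagonal `m(E) ∑ a_k²`. It remains
to use `x² ≤ M₂(x)`.

For the upper bound, split the indices into `M` residue classes, each of ratio at least `3`.
On one class `exp (∑ a_k w_{n_k})` is the Riesz product `∏ (cosh a_k + sinh a_k w_{n_k})`, whose
terms have pairwise distinct frequencies, so its integral over `E` is at most
`2 m(E) exp (∑ a_k²)`. Jensen's inequality recombines the classes, and averaging over a Gaussian
multiple of the coefficients turns the exponential moments into a bound on `∫_E exp ((c f)²)`.

Finally `ρ_E⁻¹` carries `m` to normalized Lebesgue measure on `E`, so that the local norm is a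
Luxemburg norm over `E`.
-/

section Walsh

lemma rademacher_antiperiodic (i : ℕ) :
    Function.Antiperiodic (rademacher (i + 1)) (1 / 2 ^ (i + 1)) := by
  intro t
  have hπ : (2 : ℝ) ^ (i + 1) * Real.pi * (t + 1 / 2 ^ (i + 1))
      = 2 ^ (i + 1) * Real.pi * t + Real.pi := by
    field_simp
  rw [rademacher, rademacher, hπ, Real.sin_add_pi, Real.sign_neg]

lemma rademacher_periodic {i j : ℕ} (h : i ≤ j) :
    Function.Periodic (rademacher (j + 1)) (1 / 2 ^ i) := by
  have hmul : ((2 ^ (j - i) : ℕ) : ℝ) * (2 • (1 / 2 ^ (j + 1))) = 1 / 2 ^ i := by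
    obtain ⟨d, rfl⟩ := Nat.exists_eq_add_of_le h
    rw [Nat.add_sub_cancel_left, nsmul_eq_mul]
    push_cast
    field_simp
    ring
  exact hmul ▸ (rademacher_antiperiodic j).periodic.nat_mul (2 ^ (j - i))

lemma ae_rademacher_mul_self : ∀ᵐ t : ℝ, ∀ k, rademacher k t * rademacher k t = 1 := by
  rw [ae_all_iff]
  intro k
  have hdyadic : (Set.range fun z : ℤ => (z : ℝ) / 2 ^ k).Countable := Set.countable_range _
  filter_upwards [hdyadic.ae_notMem volume] with t ht
  have hsin : Real.sin (2 ^ k * Real.pi * t) ≠ 0 := by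
    intro h
    obtain ⟨z, hz⟩ := Real.sin_eq_zero_iff.1 h
    have hzt : (z : ℝ) = 2 ^ k * t := mul_right_cancel₀ Real.pi_ne_zero (by linarith)
    exact ht ⟨z, by simp only [hzt]; field_simp⟩
  rcases Real.sign_apply_eq_of_ne_zero _ hsin with h | h <;> simp [rademacher, h]

lemma prod_mul_prod_eq_prod_symmDiff {ι R : Type*} [DecidableEq ι] [CommMonoid R] {f : ι → R}
    (hf : ∀ i, f i * f i = 1) (s t : Finset ι) :
    (∏ i ∈ s, f i) * ∏ i ∈ t, f i = ∏ i ∈ symmDiff s t, f i := by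
  have hinter : (∏ i ∈ s ∩ t, f i) * ∏ i ∈ s ∩ t, f i = 1 := by
    rw [← Finset.prod_mul_distrib, Finset.prod_eq_one fun i _ => hf i]
  rw [← Finset.prod_inter_mul_prod_sdiff s t, ← Finset.prod_inter_mul_prod_sdiff t s,
    Finset.inter_comm t s, mul_mul_mul_comm, hinter, one_mul, symmDiff_def, Finset.sup_eq_union,
    Finset.prod_union disjoint_sdiff_sdiff]

lemma toFinset_bitIndices_xor (m n : ℕ) :
    (m ^^^ n).bitIndices.toFinset = symmDiff m.bitIndices.toFinset n.bitIndices.toFinset := by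
  ext i
  simp only [List.mem_toFinset, Finset.mem_symmDiff, Nat.mem_bitIndices, Nat.testBit_xor]
  cases m.testBit i <;> cases n.testBit i <;> simp

lemma walsh_zero (t : ℝ) : walsh 0 t = 1 := by simp [walsh]

lemma ae_walsh_mul_walsh : ∀ᵐ t : ℝ, ∀ m n, walsh m t * walsh n t = walsh (m ^^^ n) t := by
  filter_upwards [ae_rademacher_mul_self] with t ht m n
  rw [walsh, walsh, prod_mul_prod_eq_prod_symmDiff fun i => ht (i + 1), walsh,
    toFinset_bitIndices_xor]

lemma walsh_periodic (n : ℕ) : Function.Periodic (walsh n) 1 := by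
  intro t
  simpa only [walsh, pow_zero, div_one] using
    Finset.prod_congr rfl fun i _ => rademacher_periodic (Nat.zero_le i) t

lemma exists_walsh_antiperiodic {n : ℕ} (hn : n ≠ 0) : ∃ c, Function.Antiperiodic (walsh n) c := by
  set I := n.bitIndices.toFinset with hI
  have hne : I.Nonempty := by
    rw [Finset.nonempty_iff_ne_empty]
    intro h
    exact hn (by rw [← Finset.sum_toFinset_bitIndices_two_pow n, ← hI, h, Finset.sum_empty])
  refine ⟨1 / 2 ^ (I.min' hne + 1), fun t => ?_⟩
  rw [walsh, walsh, ← hI, ← Finset.mul_prod_erase I _ (I.min'_mem hne),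
    ← Finset.mul_prod_erase I (fun i => rademacher (i + 1) t) (I.min'_mem hne),
    rademacher_antiperiodic, neg_mul]
  congr 2
  exact Finset.prod_congr rfl fun i hi =>
    rademacher_periodic (I.min'_lt_of_mem_erase_min' hne hi) t

lemma intervalIntegral_eq_zero_of_antiperiodic {f : ℝ → ℝ} {c T : ℝ}
    (hc : Function.Antiperiodic f c) (hT : Function.Periodic f T) (a : ℝ) :
    ∫ t in a..a + T, f t = 0 := by
  have hshift : ∫ t in a..a + T, f (t + c) = ∫ t in a..a + T, f t := by
    rw [intervalIntegral.integral_comp_add_right, add_right_comm]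
    exact hT.intervalIntegral_add_eq _ _
  simp only [hc _, intervalIntegral.integral_neg] at hshift
  linarith

instance isProbabilityMeasure_unitMeasure : IsProbabilityMeasure unitMeasure :=
  ⟨by simp [unitMeasure]⟩

lemma integral_walsh (n : ℕ) : ∫ t, walsh n t ∂unitMeasure = if n = 0 then 1 else 0 := by
  split_ifs with hn
  · simp [hn, walsh_zero]
  · obtain ⟨c, hc⟩ := exists_walsh_antiperiodic hn
    have h := intervalIntegral_eq_zero_of_antiperiodic hc (walsh_periodic n) 0
    rwa [zero_add, intervalIntegral.integral_of_le zero_le_one,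
      ← integral_Icc_eq_integral_Ioc] at h

lemma orthonormal_walshLp : Orthonormal ℝ walshLp := by
  rw [orthonormal_iff_ite]
  intro m n
  calc inner ℝ (walshLp m) (walshLp n) = ∫ t, walsh (m ^^^ n) t ∂unitMeasure := by
        rw [L2.inner_def]
        refine integral_congr_ae ?_
        filter_upwards [(memLp_walsh m).coeFn_toLp, (memLp_walsh n).coeFn_toLp,
          ae_restrict_of_ae ae_walsh_mul_walsh] with t hm hn hmul
        simp [walshLp, hm, hn, hmul, Nat.xor_comm]
    _ = if m = n then 1 else 0 := by simp [integral_walsh]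

end Walsh

section Xor

lemma xor_le_add (m n : ℕ) : m ^^^ n ≤ m + n := by
  induction m using Nat.strong_induction_on generalizing n with
  | _ m ih =>
    rcases Nat.eq_zero_or_pos m with rfl | hm
    · simp
    · have hhalf := ih (m / 2) (by omega) (n / 2)
      rw [← Nat.xor_div_two] at hhalf
      have hmod : (m ^^^ n) % 2 ≤ m % 2 + n % 2 := by
        rw [Nat.xor_mod_two_eq]
        omega
      omega

lemma le_add_xor (m n : ℕ) : n ≤ m + (m ^^^ n) := by
  simpa only [Nat.xor_xor_cancel_left] using xor_le_add m (m ^^^ n)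

variable {ι : Type*} {n : ι → ℕ}

/-- The XOR of the numbers `n i` over `i ∈ T`: the frequency of the Walsh function
`∏ i ∈ T, w_{n i}`. -/
def xorSum (n : ι → ℕ) (T : Finset ι) : ℕ := T.fold (· ^^^ ·) 0 n

lemma xorSum_empty : xorSum n ∅ = 0 := rfl

lemma xorSum_insert [DecidableEq ι] {i : ι} {T : Finset ι} (hi : i ∉ T) :
    xorSum n (insert i T) = n i ^^^ xorSum n T := Finset.fold_insert hi

lemma xorSum_symmDiff [DecidableEq ι] (s t : Finset ι) :
    xorSum n (symmDiff s t) = xorSum n s ^^^ xorSum n t := by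
  have hdisj {s t : Finset ι} (h : Disjoint s t) :
      xorSum n (s ∪ t) = xorSum n s ^^^ xorSum n t := by
    rw [← Finset.disjUnion_eq_union s t h]
    exact Finset.fold_disjUnion (op := fun a b : ℕ => a ^^^ b) (b₁ := 0) (b₂ := 0) h
  have hsplit (s t : Finset ι) : xorSum n s = xorSum n (s \ t) ^^^ xorSum n (s ∩ t) := by
    rw [← hdisj (Finset.disjoint_sdiff_inter s t), Finset.sdiff_union_inter]
  rw [symmDiff_def, Finset.sup_eq_union, hdisj disjoint_sdiff_sdiff, hsplit s t, hsplit t s,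
    Finset.inter_comm t s, Nat.xor_comm (xorSum n (t \ s)), Nat.xor_assoc, Nat.xor_xor_cancel_left]

lemma ae_prod_walsh (n : ι → ℕ) :
    ∀ᵐ t : ℝ, ∀ T : Finset ι, ∏ i ∈ T, walsh (n i) t = walsh (xorSum n T) t := by
  classical
  filter_upwards [ae_walsh_mul_walsh] with t ht T
  induction T using Finset.induction_on with
  | empty => simp [xorSum_empty, walsh_zero]
  | insert i T hi ih => rw [Finset.prod_insert hi, ih, ht, xorSum_insert hi]

variable [LinearOrder ι]

/-- The numbers `n i`, `i ∈ S`, are positive and grow by a factor of at least `3`. Distinct subsets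
of `S` then have distinct XOR sums. -/
def IsThreeLacunaryOn (n : ι → ℕ) (S : Finset ι) : Prop :=
  ∀ i ∈ S, 0 < n i ∧ ∀ j ∈ S, i < j → 3 * n i ≤ n j

lemma IsThreeLacunaryOn.mono {S T : Finset ι} (hS : IsThreeLacunaryOn n S) (hTS : T ⊆ S) :
    IsThreeLacunaryOn n T :=
  fun i hi => ⟨(hS i (hTS hi)).1, fun j hj => (hS i (hTS hi)).2 j (hTS hj)⟩

lemma IsThreeLacunaryOn.two_mul_xorSum_lt {T : Finset ι} {k : ι}
    (h : IsThreeLacunaryOn n (insert k T)) (hk : ∀ i ∈ T, i < k) : 2 * xorSum n T < n k := by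
  induction T using Finset.induction_on_max generalizing k with
  | empty => simpa [xorSum_empty] using (h k (by simp)).1
  | insert a T hT ih =>
    have hlt : 2 * xorSum n T < n a := ih (h.mono (Finset.subset_insert _ _)) hT
    have hak : 3 * n a ≤ n k := (h a (by simp)).2 k (by simp) (hk a (by simp))
    rw [xorSum_insert fun ha => (hT a ha).false]
    have := xor_le_add (n a) (xorSum n T)
    omega

lemma IsThreeLacunaryOn.exists_lt_two_mul_xorSum {T : Finset ι} (h : IsThreeLacunaryOn n T)
    (hT : T.Nonempty) : ∃ i ∈ T, n i < 2 * xorSum n T := by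
  have hmax := T.max'_mem hT
  refine ⟨T.max' hT, hmax, ?_⟩
  have hlt : 2 * xorSum n (T.erase (T.max' hT)) < n (T.max' hT) :=
    IsThreeLacunaryOn.two_mul_xorSum_lt (by rwa [Finset.insert_erase hmax])
      fun i hi => T.lt_max'_of_mem_erase_max' hT hi
  have hle := le_add_xor (xorSum n (T.erase (T.max' hT))) (n (T.max' hT))
  rw [Nat.xor_comm, ← xorSum_insert (Finset.notMem_erase _ _), Finset.insert_erase hmax] at hle
  omega

lemma IsThreeLacunaryOn.injOn_xorSum {S : Finset ι} (h : IsThreeLacunaryOn n S) :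
    Set.InjOn (xorSum n) (S.powerset : Set (Finset ι)) := by
  intro s hs t ht hst
  simp only [Finset.coe_powerset, Set.mem_preimage, Set.mem_powerset_iff, Finset.coe_subset]
    at hs ht
  by_contra hne
  have hsub : symmDiff s t ⊆ S :=
    (Finset.symmDiff_subset_union (s := s) (t := t)).trans (Finset.union_subset hs ht)
  obtain ⟨i, -, hi⟩ := (h.mono hsub).exists_lt_two_mul_xorSum
    (Finset.symmDiff_nonempty.2 hne)
  rw [xorSum_symmDiff, hst, Nat.xor_self] at hi
  omega

end Xor

section Tail

variable {μ : Measure ℝ}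

/-- The Walsh coefficients of `μ` at frequencies at least `L` have square sum at most `δ`. -/
def WalshTailLE (μ : Measure ℝ) (L : ℕ) (δ : ℝ) : Prop :=
  ∀ F : Finset ℕ, (∀ d ∈ F, L ≤ d) → ∑ d ∈ F, (∫ t, walsh d t ∂μ) ^ 2 ≤ δ

lemma WalshTailLE.nonneg {L : ℕ} {δ : ℝ} (h : WalshTailLE μ L δ) : 0 ≤ δ := by
  simpa using h ∅ (by simp)

lemma summable_sq_integral_walsh (hμ : μ ≤ unitMeasure) :
    Summable fun d => (∫ t, walsh d t ∂μ) ^ 2 := by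
  set g : ℝ → ℝ := fun t => (μ.rnDeriv unitMeasure t).toReal
  have hg : MemLp g 2 unitMeasure := by
    have : IsFiniteMeasure μ := isFiniteMeasure_of_le _ hμ
    refine MemLp.of_bound
      (Measure.measurable_rnDeriv μ unitMeasure).ennreal_toReal.aestronglyMeasurable 1 ?_
    filter_upwards [Measure.rnDeriv_le_one_of_le hμ] with t ht
    rw [Real.norm_of_nonneg ENNReal.toReal_nonneg]
    exact ENNReal.toReal_mono ENNReal.one_ne_top ht
  have hcoeff (d : ℕ) : inner ℝ (walshLp d) (hg.toLp g) = ∫ t, walsh d t ∂μ := by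
    have : IsFiniteMeasure μ := isFiniteMeasure_of_le _ hμ
    rw [L2.inner_def, ← integral_toReal_rnDeriv_mul (Measure.absolutelyContinuous_of_le hμ)]
    refine integral_congr_ae ?_
    filter_upwards [(memLp_walsh d).coeFn_toLp, hg.coeFn_toLp] with t hw hgt
    simp [walshLp, hw, hgt, g]
  simpa only [hcoeff, Real.norm_eq_abs, sq_abs] using
    orthonormal_walshLp.inner_products_summable (hg.toLp g)

lemma exists_walshTailLE (hμ : μ ≤ unitMeasure) {δ : ℝ} (hδ : 0 < δ) :
    ∃ L, WalshTailLE μ L δ := by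
  obtain ⟨s, hs⟩ := summable_iff_vanishing_norm.1 (summable_sq_integral_walsh hμ) δ hδ
  refine ⟨s.sup id + 1, fun F hF => (le_abs_self _).trans (hs F ?_).le⟩
  refine Finset.disjoint_left.2 fun d hd hds => ?_
  have := hF d hd
  have : d ≤ s.sup id := Finset.le_sup (f := id) hds
  omega

lemma WalshTailLE.sq_sum_mul_integral_le {L : ℕ} {δ : ℝ} (h : WalshTailLE μ L δ) {ι : Type*}
    {P : Finset ι} {D : ι → ℕ} (hD : ∀ p ∈ P, L ≤ D p) {M : ℕ}
    (hM : ∀ d, (P.filter fun p => D p = d).card ≤ M) (c : ι → ℝ) :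
    (∑ p ∈ P, c p * ∫ t, walsh (D p) t ∂μ) ^ 2 ≤ (∑ p ∈ P, c p ^ 2) * (M * δ) := by
  have hcoeff : ∑ p ∈ P, (∫ t, walsh (D p) t ∂μ) ^ 2 ≤ M * δ :=
    calc ∑ p ∈ P, (∫ t, walsh (D p) t ∂μ) ^ 2
        = ∑ d ∈ P.image D, (P.filter fun p => D p = d).card • (∫ t, walsh d t ∂μ) ^ 2 :=
          Finset.sum_comp (fun d => (∫ t, walsh d t ∂μ) ^ 2) D
      _ ≤ ∑ d ∈ P.image D, M * (∫ t, walsh d t ∂μ) ^ 2 := by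
          refine Finset.sum_le_sum fun d _ => ?_
          rw [nsmul_eq_mul]
          gcongr
          exact hM d
      _ ≤ M * δ := by
          rw [← Finset.mul_sum]
          gcongr
          exact h _ (Finset.forall_mem_image.2 hD)
  calc (∑ p ∈ P, c p * ∫ t, walsh (D p) t ∂μ) ^ 2
      ≤ (∑ p ∈ P, c p ^ 2) * ∑ p ∈ P, (∫ t, walsh (D p) t ∂μ) ^ 2 :=
        Finset.sum_mul_sq_le_sq_mul_sq _ _ _
    _ ≤ (∑ p ∈ P, c p ^ 2) * (M * δ) := by
        gcongr

end Tail

section FiniteSums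

variable {μ : Measure ℝ} [IsFiniteMeasure μ] {ι : Type*}

lemma integrable_walsh (d : ℕ) : Integrable (walsh d) μ :=
  .of_bound (measurable_walsh d).aestronglyMeasurable 1
    (Filter.Eventually.of_forall fun t => abs_walsh_le_one d t)

lemma measurable_sum_walsh (a : ι → ℝ) (n : ι → ℕ) (S : Finset ι) :
    Measurable fun t => ∑ k ∈ S, a k * walsh (n k) t :=
  Finset.measurable_fun_sum _ fun k _ => (measurable_walsh (n k)).const_mul _

lemma integrable_exp_sum_walsh (a : ι → ℝ) (n : ι → ℕ) (S : Finset ι) :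
    Integrable (fun t => Real.exp (∑ k ∈ S, a k * walsh (n k) t)) μ := by
  refine .of_bound (measurable_sum_walsh a n S).exp.aestronglyMeasurable
    (Real.exp (∑ k ∈ S, |a k|)) (Filter.Eventually.of_forall fun t => ?_)
  rw [Real.norm_eq_abs, Real.abs_exp]
  refine Real.exp_le_exp.2 (Finset.sum_le_sum fun k _ => ?_)
  calc a k * walsh (n k) t ≤ |a k| * |walsh (n k) t| := (le_abs_self _).trans (abs_mul _ _).le
    _ ≤ |a k| := mul_le_of_le_one_right (abs_nonneg _) (abs_walsh_le_one _ _)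

variable {n : ι → ℕ} {S : Finset ι}

lemma integral_prod_add_mul_walsh [DecidableEq ι] (hμ : μ ≪ volume) (α β : ι → ℝ) :
    ∫ t, ∏ i ∈ S, (α i + β i * walsh (n i) t) ∂μ
      = ∑ T ∈ S.powerset,
        (∏ i ∈ S \ T, α i) * (∏ i ∈ T, β i) * ∫ t, walsh (xorSum n T) t ∂μ := by
  simp only [← integral_const_mul]
  rw [← integral_finsetSum _ fun T _ => (integrable_walsh _).const_mul _]
  refine integral_congr_ae ?_
  filter_upwards [hμ.ae_le (ae_prod_walsh n)] with t ht
  simp only [add_comm (α _), Finset.prod_add, Finset.prod_mul_distrib, ht]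
  exact Finset.sum_congr rfl fun T _ => by ring

lemma exp_mul_eq_cosh_add_sinh_mul {x w : ℝ} (hw : w * w = 1) :
    Real.exp (x * w) = Real.cosh x + Real.sinh x * w := by
  rcases mul_self_eq_one_iff.1 hw with rfl | rfl
  · simp [Real.cosh_add_sinh]
  · simp [← Real.cosh_sub_sinh, sub_eq_add_neg]

lemma prod_cosh_le_exp_sum_sq (S : Finset ι) (a : ι → ℝ) :
    ∏ i ∈ S, Real.cosh (a i) ≤ Real.exp (∑ i ∈ S, a i ^ 2) := by
  rw [Real.exp_sum]
  refine Finset.prod_le_prod (fun i _ => (Real.cosh_pos _).le) fun i _ => ?_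
  refine (Real.cosh_le_exp_half_sq _).trans (Real.exp_le_exp.2 ?_)
  linarith [sq_nonneg (a i)]

lemma prod_cosh_sq_add_sinh_sq_le_exp_sum_sq (S : Finset ι) (a : ι → ℝ) :
    ∏ i ∈ S, (Real.cosh (a i) ^ 2 + Real.sinh (a i) ^ 2) ≤ Real.exp (∑ i ∈ S, a i ^ 2) ^ 2 := by
  rw [Real.exp_sum, ← Finset.prod_pow]
  refine Finset.prod_le_prod (fun i _ => by positivity) fun i _ => ?_
  rw [← Real.cosh_two_mul, ← Real.exp_nat_mul]
  refine (Real.cosh_le_exp_half_sq _).trans (Real.exp_le_exp.2 ?_)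
  push_cast
  linarith

variable [LinearOrder ι]

lemma WalshTailLE.integral_prod_add_mul_walsh_le {L : ℕ} {δ : ℝ} (h : WalshTailLE μ L δ)
    (hμ : μ ≪ volume) (hS : IsThreeLacunaryOn n S) (hL : ∀ i ∈ S, 2 * L ≤ n i) (α β : ι → ℝ) :
    ∫ t, ∏ i ∈ S, (α i + β i * walsh (n i) t) ∂μ
      ≤ μ.real Set.univ * ∏ i ∈ S, α i + √((∏ i ∈ S, (α i ^ 2 + β i ^ 2)) * δ) := by
  set c : Finset ι → ℝ := fun T => (∏ i ∈ S \ T, α i) * ∏ i ∈ T, β i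
  have hxor : ∀ T ∈ S.powerset.erase ∅, L ≤ xorSum n T := by
    intro T hT
    rw [Finset.mem_erase, Finset.mem_powerset] at hT
    obtain ⟨i, hi, hlt⟩ := (hS.mono hT.2).exists_lt_two_mul_xorSum
      (Finset.nonempty_iff_ne_empty.2 hT.1)
    have := hL i (hT.2 hi)
    omega
  have hfiber (d : ℕ) : ((S.powerset.erase ∅).filter fun T => xorSum n T = d).card ≤ 1 := by
    refine Finset.card_le_one.2 fun T hT T' hT' => ?_
    rw [Finset.mem_filter, Finset.mem_erase] at hT hT'
    exact hS.injOn_xorSum hT.1.2 hT'.1.2 (hT.2.trans hT'.2.symm)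
  have hsq : ∑ T ∈ S.powerset.erase ∅, c T ^ 2 ≤ ∏ i ∈ S, (α i ^ 2 + β i ^ 2) := by
    simp only [add_comm (α _ ^ 2), Finset.prod_add]
    refine (Finset.sum_le_sum_of_subset_of_nonneg (Finset.erase_subset _ _)
      fun T _ _ => sq_nonneg (c T)).trans_eq (Finset.sum_congr rfl fun T _ => ?_)
    rw [mul_pow, Finset.prod_pow, Finset.prod_pow, mul_comm]
  have hδ : 0 ≤ δ := h.nonneg
  have htail := h.sq_sum_mul_integral_le hxor hfiber c
  rw [Nat.cast_one, one_mul] at htail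
  rw [integral_prod_add_mul_walsh hμ, ← Finset.add_sum_erase _ _ S.empty_mem_powerset]
  refine add_le_add (le_of_eq ?_) ?_
  · simp [xorSum_empty, walsh_zero, mul_comm]
  · exact Real.le_sqrt_of_sq_le (htail.trans (by gcongr))

lemma WalshTailLE.integral_exp_sum_walsh_le {L : ℕ} {δ : ℝ} (h : WalshTailLE μ L δ)
    (hμ : μ ≪ volume) (hδ : δ ≤ μ.real Set.univ ^ 2) (hS : IsThreeLacunaryOn n S)
    (hL : ∀ i ∈ S, 2 * L ≤ n i) (a : ι → ℝ) :
    ∫ t, Real.exp (∑ i ∈ S, a i * walsh (n i) t) ∂μ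
      ≤ 2 * μ.real Set.univ * Real.exp (∑ i ∈ S, a i ^ 2) := by
  have hprod : ∫ t, Real.exp (∑ i ∈ S, a i * walsh (n i) t) ∂μ
      = ∫ t, ∏ i ∈ S, (Real.cosh (a i) + Real.sinh (a i) * walsh (n i) t) ∂μ := by
    refine integral_congr_ae ?_
    filter_upwards [hμ.ae_le ae_walsh_mul_walsh] with t ht
    have hsq (i : ι) : walsh (n i) t * walsh (n i) t = 1 := by
      rw [ht, Nat.xor_self, walsh_zero]
    simp only [Real.exp_sum, exp_mul_eq_cosh_add_sinh_mul (hsq _)]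
  calc ∫ t, Real.exp (∑ i ∈ S, a i * walsh (n i) t) ∂μ
      ≤ μ.real Set.univ * ∏ i ∈ S, Real.cosh (a i)
        + √((∏ i ∈ S, (Real.cosh (a i) ^ 2 + Real.sinh (a i) ^ 2)) * δ) :=
        hprod.trans_le (h.integral_prod_add_mul_walsh_le hμ hS hL _ _)
    _ ≤ μ.real Set.univ * Real.exp (∑ i ∈ S, a i ^ 2)
        + √((Real.exp (∑ i ∈ S, a i ^ 2) * μ.real Set.univ) ^ 2) := by
        rw [mul_pow]
        have hδ0 : 0 ≤ δ := h.nonneg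
        gcongr
        · exact prod_cosh_le_exp_sum_sq S a
        · exact prod_cosh_sq_add_sinh_sq_le_exp_sum_sq S a
    _ = 2 * μ.real Set.univ * Real.exp (∑ i ∈ S, a i ^ 2) := by
        rw [Real.sqrt_sq (by positivity)]
        ring

end FiniteSums

section Lacunary

variable {q : ℝ} {n : ℕ → ℕ}

lemma IsLacunary.pow_mul_le (h : IsLacunary q n) (hq : 0 ≤ q) (k d : ℕ) :
    q ^ d * n k ≤ n (k + d) := by
  induction d with
  | zero => simp
  | succ d ih =>
    calc q ^ (d + 1) * n k = q * (q ^ d * n k) := by ring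
      _ ≤ q * n (k + d) := by gcongr
      _ ≤ n (k + (d + 1)) :=
          (le_div_iff₀ (Nat.cast_pos.2 (h (k + d)).1)).1 (h (k + d)).2

lemma IsLacunary.strictMono (h : IsLacunary q n) (hq : 1 < q) : StrictMono n := by
  refine strictMono_nat_of_lt_succ fun k => ?_
  have hpos : (0 : ℝ) < n k := Nat.cast_pos.2 (h k).1
  have hle := h.pow_mul_le (by positivity) k 1
  rw [pow_one] at hle
  exact_mod_cast (by nlinarith : (n k : ℝ) < n (k + 1))

lemma IsLacunary.mul_le_mul_xor (h : IsLacunary q n) (hq : 1 < q) {j k : ℕ} (hjk : j < k) :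
    (q - 1) * n k ≤ q * (n j ^^^ n k : ℕ) := by
  have hxor : (n k : ℝ) ≤ n j + (n j ^^^ n k : ℕ) := by exact_mod_cast le_add_xor (n j) (n k)
  have hlac : q * n j ≤ n k := by
    have hmono : n (j + 1) ≤ n k := (h.strictMono hq).monotone hjk
    have hle := h.pow_mul_le (by positivity) j 1
    rw [pow_one] at hle
    exact hle.trans (by exact_mod_cast hmono)
  nlinarith

lemma IsLacunary.lt_add_of_xor_eq (h : IsLacunary q n) (hq : 1 < q) {M : ℕ}
    (hM : 2 * q ≤ (q - 1) * q ^ M) {j k j' k' : ℕ} (hjk : j < k) (hjk' : j' < k')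
    (heq : n j ^^^ n k = n j' ^^^ n k') : k' < k + M := by
  by_contra! hle
  have hxor : ((n j' ^^^ n k' : ℕ) : ℝ) < 2 * n k := by
    have hle := xor_le_add (n j) (n k)
    have hlt := h.strictMono hq hjk
    rw [← heq]
    exact_mod_cast (by omega : n j ^^^ n k < 2 * n k)
  have hgrow : q ^ M * n k ≤ n k' :=
    (h.pow_mul_le (by positivity) k M).trans
      (by exact_mod_cast (h.strictMono hq).monotone hle)
  have hlow := h.mul_le_mul_xor hq hjk'
  have hpos : (0 : ℝ) ≤ n k := Nat.cast_nonneg _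
  nlinarith [mul_le_mul_of_nonneg_right hM hpos, mul_le_mul_of_nonneg_left hgrow (sub_pos.2 hq).le]

lemma IsLacunary.card_xor_fiber_le (h : IsLacunary q n) (hq : 1 < q) {M : ℕ}
    (hM : 2 * q ≤ (q - 1) * q ^ M) (m d : ℕ) :
    (((Finset.range m).sigma Finset.range).filter fun p => n p.2 ^^^ n p.1 = d).card ≤ M := by
  have hM0 : 0 < M := by
    by_contra! hM0
    rw [Nat.le_zero.1 hM0, pow_zero] at hM
    linarith
  rw [← Finset.card_range M]
  refine Finset.card_le_card_of_injOn (fun p => p.1 % M)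
    (fun p _ => Finset.mem_coe.2 (Finset.mem_range.2 (Nat.mod_lt _ hM0))) ?_
  rintro ⟨k, j⟩ hp ⟨k', j'⟩ hp' hmod
  simp only [Finset.coe_filter, Finset.mem_sigma, Finset.mem_range, Set.mem_ofPred_eq] at hp hp'
  have hxor : n j ^^^ n k = n j' ^^^ n k' := hp.2.trans hp'.2.symm
  have hk : k = k' := by
    have h1 := h.lt_add_of_xor_eq hq hM hp.1.2 hp'.1.2 hxor
    have h2 := h.lt_add_of_xor_eq hq hM hp'.1.2 hp.1.2 hxor.symm
    exact Nat.ModEq.eq_of_abs_lt hmod (by rw [abs_lt]; omega)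
  subst hk
  rw [Nat.xor_left_inj] at hxor
  rw [(h.strictMono hq).injective hxor]

lemma sq_sum_range (x : ℕ → ℝ) (m : ℕ) :
    (∑ k ∈ Finset.range m, x k) ^ 2
      = ∑ k ∈ Finset.range m, x k ^ 2
        + 2 * ∑ p ∈ (Finset.range m).sigma Finset.range, x p.2 * x p.1 := by
  rw [Finset.sum_sigma]
  induction m with
  | zero => simp
  | succ m ih =>
    rw [Finset.sum_range_succ, add_sq, ih]
    simp only [Finset.sum_range_succ, ← Finset.sum_mul]
    ring

variable {μ : Measure ℝ} [IsFiniteMeasure μ] {L : ℕ} {δ : ℝ}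

lemma integral_sq_sum_walsh (hμ : μ ≪ volume) (n : ℕ → ℕ) (a : ℕ → ℝ) (m : ℕ) :
    ∫ t, (∑ k ∈ Finset.range m, a k * walsh (n k) t) ^ 2 ∂μ
      = μ.real Set.univ * ∑ k ∈ Finset.range m, a k ^ 2
        + 2 * ∑ p ∈ (Finset.range m).sigma Finset.range,
          a p.2 * a p.1 * ∫ t, walsh (n p.2 ^^^ n p.1) t ∂μ := by
  have hexpand : ∀ᵐ t ∂μ, (∑ k ∈ Finset.range m, a k * walsh (n k) t) ^ 2
      = ∑ k ∈ Finset.range m, a k ^ 2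
        + 2 * ∑ p ∈ (Finset.range m).sigma Finset.range,
          a p.2 * a p.1 * walsh (n p.2 ^^^ n p.1) t := by
    filter_upwards [hμ.ae_le ae_walsh_mul_walsh] with t ht
    simp only [sq_sum_range, mul_mul_mul_comm _ (walsh _ _), mul_pow, sq (walsh _ _), ht,
      Nat.xor_self, walsh_zero, mul_one]
  have hint : ∀ p ∈ (Finset.range m).sigma Finset.range,
      Integrable (fun t => a p.2 * a p.1 * walsh (n p.2 ^^^ n p.1) t) μ :=
    fun p _ => (integrable_walsh _).const_mul _
  rw [integral_congr_ae hexpand,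
    integral_add (integrable_const _) ((integrable_finsetSum _ hint).const_mul 2),
    integral_const, smul_eq_mul, integral_const_mul, integral_finsetSum _ hint]
  simp only [integral_const_mul]

lemma WalshTailLE.half_mul_sum_sq_le_integral (hc : WalshTailLE μ L δ) (hμ : μ ≪ volume)
    (h : IsLacunary q n) (hq : 1 < q) (hL : ∀ k, L * q ≤ (q - 1) * n k) {M : ℕ}
    (hM : 2 * q ≤ (q - 1) * q ^ M) (hδ : 8 * (M * δ) ≤ μ.real Set.univ ^ 2) (a : ℕ → ℝ) (m : ℕ) :
    μ.real Set.univ / 2 * ∑ k ∈ Finset.range m, a k ^ 2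
      ≤ ∫ t, (∑ k ∈ Finset.range m, a k * walsh (n k) t) ^ 2 ∂μ := by
  set P := (Finset.range m).sigma Finset.range
  set σ := ∑ k ∈ Finset.range m, a k ^ 2
  set v := μ.real Set.univ
  have : 0 ≤ σ := Finset.sum_nonneg fun k _ => sq_nonneg _
  have hlarge : ∀ p ∈ P, L ≤ n p.2 ^^^ n p.1 := by
    intro p hp
    have hxor := h.mul_le_mul_xor hq (Finset.mem_range.1 (Finset.mem_sigma.1 hp).2)
    have : (L : ℝ) ≤ (n p.2 ^^^ n p.1 : ℕ) := by nlinarith [hL p.1]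
    exact_mod_cast this
  have hpairs : 2 * ∑ p ∈ P, (a p.2 * a p.1) ^ 2 ≤ σ ^ 2 := by
    simp only [mul_pow]
    rw [sq_sum_range fun k => a k ^ 2]
    exact le_add_of_nonneg_left (Finset.sum_nonneg fun k _ => sq_nonneg _)
  have htail := hc.sq_sum_mul_integral_le hlarge (h.card_xor_fiber_le hq hM m)
    fun p => a p.2 * a p.1
  have hcross : |∑ p ∈ P, a p.2 * a p.1 * ∫ t, walsh (n p.2 ^^^ n p.1) t ∂μ| ≤ v * σ / 4 := by
    refine abs_le_of_sq_le_sq (htail.trans ?_) (by positivity)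
    have hδ0 : 0 ≤ δ := hc.nonneg
    nlinarith [mul_le_mul hpairs hδ (by positivity) (sq_nonneg σ)]
  rw [integral_sq_sum_walsh hμ]
  linarith [neg_le_of_abs_le hcross]

lemma IsLacunary.isThreeLacunaryOn_filter_mod (h : IsLacunary q n) (hq : 1 < q) {M : ℕ}
    (hM : 3 ≤ q ^ M) (m r : ℕ) :
    IsThreeLacunaryOn n ((Finset.range m).filter fun k => k % M = r) := by
  refine fun i hi => ⟨(h i).1, fun j hj hij => ?_⟩
  rw [Finset.mem_filter] at hi hj
  have hle : i + M ≤ j := by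
    by_contra! hlt
    exact hij.ne (Nat.ModEq.eq_of_abs_lt (hi.2.trans hj.2.symm) (by rw [abs_lt]; omega))
  have hreal : (3 : ℝ) * n i ≤ n j :=
    calc (3 : ℝ) * n i ≤ q ^ M * n i := by gcongr
      _ ≤ n (i + M) := h.pow_mul_le (by positivity) i M
      _ ≤ n j := by exact_mod_cast (h.strictMono hq).monotone hle
  exact_mod_cast hreal

lemma exp_sum_le_sum_exp_card_mul {ι : Type*} {S : Finset ι} (hS : S.Nonempty) (x : ι → ℝ) :
    Real.exp (∑ r ∈ S, x r) ≤ (S.card : ℝ)⁻¹ * ∑ r ∈ S, Real.exp (S.card * x r) := by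
  have hcard : (S.card : ℝ) ≠ 0 := by exact_mod_cast hS.card_pos.ne'
  have hjensen := convexOn_exp.map_sum_le (t := S) (w := fun _ => (S.card : ℝ)⁻¹)
    (p := fun r => S.card * x r) (fun _ _ => by positivity) (by simp [hcard])
    fun _ _ => Set.mem_univ _
  simpa only [smul_eq_mul, inv_mul_cancel_left₀ hcard, ← Finset.mul_sum] using hjensen

lemma exp_sum_range_le_sum_exp_filter_mod (x : ℕ → ℝ) (m : ℕ) {M : ℕ} (hM : 0 < M) :
    Real.exp (∑ k ∈ Finset.range m, x k)
      ≤ (M : ℝ)⁻¹ * ∑ r ∈ Finset.range M,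
        Real.exp (∑ k ∈ Finset.range m with k % M = r, M * x k) := by
  have hle := exp_sum_le_sum_exp_card_mul (Finset.nonempty_range_iff.2 hM.ne')
    fun r => ∑ k ∈ Finset.range m with k % M = r, x k
  rw [Finset.sum_fiberwise_of_maps_to fun k _ => Finset.mem_range.2 (Nat.mod_lt k hM),
    Finset.card_range] at hle
  simpa only [Finset.mul_sum] using hle

lemma WalshTailLE.integral_exp_sum_walsh_le_of_isLacunary (hc : WalshTailLE μ L δ)
    (hμ : μ ≪ volume) (hδ : δ ≤ μ.real Set.univ ^ 2) (h : IsLacunary q n) (hq : 1 < q)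
    (hL : ∀ k, 2 * L ≤ n k) {M : ℕ} (hM : 3 ≤ q ^ M) (a : ℕ → ℝ) (m : ℕ) :
    ∫ t, Real.exp (∑ k ∈ Finset.range m, a k * walsh (n k) t) ∂μ
      ≤ 2 * μ.real Set.univ * Real.exp (M ^ 2 * ∑ k ∈ Finset.range m, a k ^ 2) := by
  have hM0 : 0 < M := by
    by_contra! hM0
    rw [Nat.le_zero.1 hM0, pow_zero] at hM
    norm_num at hM
  set X : ℕ → ℝ → ℝ := fun r t =>
    ∑ k ∈ Finset.range m with k % M = r, M * a k * walsh (n k) t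
  have hjensen (t : ℝ) : Real.exp (∑ k ∈ Finset.range m, a k * walsh (n k) t)
      ≤ (M : ℝ)⁻¹ * ∑ r ∈ Finset.range M, Real.exp (X r t) := by
    simpa only [X, mul_assoc] using
      exp_sum_range_le_sum_exp_filter_mod (fun k => a k * walsh (n k) t) m hM0
  have hclass (r : ℕ) : ∫ t, Real.exp (X r t) ∂μ
      ≤ 2 * μ.real Set.univ * Real.exp (M ^ 2 * ∑ k ∈ Finset.range m, a k ^ 2) := by
    refine (hc.integral_exp_sum_walsh_le hμ hδ (h.isThreeLacunaryOn_filter_mod hq hM m r)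
      (fun k _ => hL k) _).trans ?_
    simp only [mul_pow, ← Finset.mul_sum]
    gcongr
    exact Finset.filter_subset _ _
  have hint (r : ℕ) : Integrable (fun t => Real.exp (X r t)) μ := integrable_exp_sum_walsh _ _ _
  calc ∫ t, Real.exp (∑ k ∈ Finset.range m, a k * walsh (n k) t) ∂μ
      ≤ ∫ t, (M : ℝ)⁻¹ * ∑ r ∈ Finset.range M, Real.exp (X r t) ∂μ :=
        integral_mono (integrable_exp_sum_walsh _ _ _)
          ((integrable_finsetSum _ fun r _ => hint r).const_mul _) hjensen
    _ = (M : ℝ)⁻¹ * ∑ r ∈ Finset.range M, ∫ t, Real.exp (X r t) ∂μ := by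
        rw [integral_const_mul, integral_finsetSum _ fun r _ => hint r]
    _ ≤ (M : ℝ)⁻¹ * ∑ r ∈ Finset.range M,
          2 * μ.real Set.univ * Real.exp (M ^ 2 * ∑ k ∈ Finset.range m, a k ^ 2) := by
        gcongr with r
        exact hclass r
    _ = 2 * μ.real Set.univ * Real.exp (M ^ 2 * ∑ k ∈ Finset.range m, a k ^ 2) := by
        rw [Finset.sum_const, Finset.card_range, nsmul_eq_mul,
          inv_mul_cancel_left₀ (by positivity)]

end Lacunary

section Gaussian

open ProbabilityTheory

lemma lintegral_exp_mul_gaussianReal (x : ℝ) :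
    ∫⁻ y, ENNReal.ofReal (Real.exp (x * y)) ∂gaussianReal 0 1
      = ENNReal.ofReal (Real.exp (x ^ 2 / 2)) := by
  have hmgf := congrFun (mgf_id_gaussianReal (μ := 0) (v := 1)) x
  simp only [mgf, id, zero_mul, NNReal.coe_one, one_mul, zero_add] at hmgf
  rw [← ofReal_integral_eq_lintegral_ofReal (integrable_exp_mul_gaussianReal x)
    (Filter.Eventually.of_forall fun y => (Real.exp_pos _).le), hmgf]

lemma lintegral_exp_sq_gaussianReal_le :
    ∫⁻ y, ENNReal.ofReal (Real.exp (y ^ 2 / 4)) ∂gaussianReal 0 1 ≤ 2 := by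
  have hdensity (y : ℝ) : (gaussianPDF 0 1 * fun y => ENNReal.ofReal (Real.exp (y ^ 2 / 4))) y
      = ENNReal.ofReal ((√(2 * Real.pi))⁻¹ * Real.exp (-(1 / 4) * y ^ 2)) := by
    rw [Pi.mul_apply, gaussianPDF, ← ENNReal.ofReal_mul (gaussianPDFReal_nonneg 0 1 y),
      gaussianPDFReal, mul_assoc, ← Real.exp_add]
    norm_num
    ring_nf
  rw [gaussianReal_of_var_ne_zero 0 one_ne_zero, lintegral_withDensity_eq_lintegral_mul _
    (measurable_gaussianPDF 0 1) (by fun_prop)]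
  simp only [hdensity]
  rw [← ofReal_integral_eq_lintegral_ofReal
    ((integrable_exp_neg_mul_sq (by norm_num)).const_mul _)
    (Filter.Eventually.of_forall fun y => by positivity), integral_const_mul, integral_gaussian,
    ← ENNReal.ofReal_ofNat]
  refine ENNReal.ofReal_le_ofReal ((inv_mul_le_iff₀ (by positivity)).2 ?_)
  refine Real.sqrt_le_iff.2 ⟨by positivity, ?_⟩
  rw [mul_pow, Real.sq_sqrt (by positivity)]
  linarith [Real.pi_pos]

variable {Ω : Type*} [MeasurableSpace Ω] {μ : Measure Ω} {X : Ω → ℝ}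

-- Writing `exp (X² / 2)` as a Gaussian average of `exp (X y)` reduces it to exponential moments.
lemma lintegral_exp_half_sq_le [SFinite μ] (hX : Measurable X) {C : ℝ≥0∞}
    (h : ∀ y : ℝ, ∫⁻ t, ENNReal.ofReal (Real.exp (X t * y)) ∂μ
      ≤ C * ENNReal.ofReal (Real.exp (y ^ 2 / 4))) :
    ∫⁻ t, ENNReal.ofReal (Real.exp (X t ^ 2 / 2)) ∂μ ≤ 2 * C := by
  calc ∫⁻ t, ENNReal.ofReal (Real.exp (X t ^ 2 / 2)) ∂μ
      = ∫⁻ t, ∫⁻ y, ENNReal.ofReal (Real.exp (X t * y)) ∂gaussianReal 0 1 ∂μ := by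
        simp only [lintegral_exp_mul_gaussianReal]
    _ = ∫⁻ y, ∫⁻ t, ENNReal.ofReal (Real.exp (X t * y)) ∂μ ∂gaussianReal 0 1 :=
        lintegral_lintegral_swap (by fun_prop)
    _ ≤ ∫⁻ y, C * ENNReal.ofReal (Real.exp (y ^ 2 / 4)) ∂gaussianReal 0 1 := lintegral_mono h
    _ = C * ∫⁻ y, ENNReal.ofReal (Real.exp (y ^ 2 / 4)) ∂gaussianReal 0 1 :=
        lintegral_const_mul _ (by fun_prop)
    _ ≤ 2 * C := by
        rw [mul_comm]
        gcongr
        exact lintegral_exp_sq_gaussianReal_le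

lemma youngM2_abs_half_le (x : ℝ) : youngM2 (|x| / 2) ≤ 4⁻¹ * Real.exp (x ^ 2 / 2) := by
  have hsq : Real.exp (x ^ 2 / 2) = Real.exp (x ^ 2 / 4) ^ 2 := by
    rw [← Real.exp_nat_mul]
    congr 1
    push_cast
    ring
  rw [youngM2, div_pow, sq_abs, hsq]
  norm_num
  linarith [sq_nonneg (Real.exp (x ^ 2 / 4) - 2)]

lemma lintegral_youngM2_abs_half_le [SFinite μ] (hX : Measurable X)
    (h : ∀ y : ℝ, ∫⁻ t, ENNReal.ofReal (Real.exp (X t * y)) ∂μ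
      ≤ 2 * μ Set.univ * ENNReal.ofReal (Real.exp (y ^ 2 / 4))) :
    ∫⁻ t, ENNReal.ofReal (youngM2 (|X t| / 2)) ∂μ ≤ μ Set.univ := by
  have hinv : ENNReal.ofReal 4⁻¹ * 4 = 1 := by
    rw [← ENNReal.ofReal_ofNat, ← ENNReal.ofReal_mul (by norm_num)]
    norm_num
  calc ∫⁻ t, ENNReal.ofReal (youngM2 (|X t| / 2)) ∂μ
      ≤ ∫⁻ t, ENNReal.ofReal 4⁻¹ * ENNReal.ofReal (Real.exp (X t ^ 2 / 2)) ∂μ :=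
        lintegral_mono fun t => by
          rw [← ENNReal.ofReal_mul (by norm_num)]
          exact ENNReal.ofReal_le_ofReal (youngM2_abs_half_le _)
    _ = ENNReal.ofReal 4⁻¹ * ∫⁻ t, ENNReal.ofReal (Real.exp (X t ^ 2 / 2)) ∂μ :=
        lintegral_const_mul' _ _ ENNReal.ofReal_ne_top
    _ ≤ ENNReal.ofReal 4⁻¹ * (2 * (2 * μ Set.univ)) := by
        gcongr
        exact lintegral_exp_half_sq_le hX h
    _ = μ Set.univ := by
        rw [← mul_assoc 2 2, ← mul_assoc, show (2 * 2 : ℝ≥0∞) = 4 by norm_num, hinv, one_mul]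

end Gaussian

lemma WalshTailLE.lintegral_youngM2_sum_le {μ : Measure ℝ} [IsFiniteMeasure μ] {q δ : ℝ} {L : ℕ}
    {n : ℕ → ℕ} (hc : WalshTailLE μ L δ) (hμ : μ ≪ volume) (hδ : δ ≤ μ.real Set.univ ^ 2)
    (h : IsLacunary q n) (hq : 1 < q) (hL : ∀ k, 2 * L ≤ n k) {M : ℕ} (hM : 3 ≤ q ^ M)
    {a : ℕ → ℝ} {s : ℝ} (hs : 0 < s) {m : ℕ} (ha : M ^ 2 * ∑ k ∈ Finset.range m, a k ^ 2 ≤ s ^ 2) :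
    ∫⁻ t, ENNReal.ofReal (youngM2 (|∑ k ∈ Finset.range m, a k * walsh (n k) t| / (4 * s))) ∂μ
      ≤ μ Set.univ := by
  set X : ℝ → ℝ := fun t => (∑ k ∈ Finset.range m, a k * walsh (n k) t) / (2 * s) with hX
  have hscale (t : ℝ) : |∑ k ∈ Finset.range m, a k * walsh (n k) t| / (4 * s) = |X t| / 2 := by
    rw [hX, abs_div, abs_of_pos (by positivity : 0 < 2 * s), div_div]
    ring_nf
  simp only [hscale]
  refine lintegral_youngM2_abs_half_le ((measurable_sum_walsh a n _).div_const _) fun y => ?_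
  set b : ℕ → ℝ := fun k => a k * (y / (2 * s)) with hb
  have hXy (t : ℝ) : X t * y = ∑ k ∈ Finset.range m, b k * walsh (n k) t := by
    rw [hX, hb, div_mul_eq_mul_div, mul_div_assoc, Finset.sum_mul]
    exact Finset.sum_congr rfl fun k _ => by ring
  have hb2 : M ^ 2 * ∑ k ∈ Finset.range m, b k ^ 2 ≤ y ^ 2 / 4 :=
    calc M ^ 2 * ∑ k ∈ Finset.range m, b k ^ 2
        = (M ^ 2 * ∑ k ∈ Finset.range m, a k ^ 2) * (y / (2 * s)) ^ 2 := by
          simp only [hb, mul_pow, ← Finset.sum_mul, mul_assoc]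
      _ ≤ s ^ 2 * (y / (2 * s)) ^ 2 := by gcongr
      _ = y ^ 2 / 4 := by field_simp; ring
  simp only [hXy]
  rw [← ofReal_integral_eq_lintegral_ofReal (integrable_exp_sum_walsh b n _)
    (Filter.Eventually.of_forall fun t => (Real.exp_pos _).le)]
  calc ENNReal.ofReal (∫ t, Real.exp (∑ k ∈ Finset.range m, b k * walsh (n k) t) ∂μ)
      ≤ ENNReal.ofReal (2 * μ.real Set.univ * Real.exp (y ^ 2 / 4)) := by
        refine ENNReal.ofReal_le_ofReal
          ((hc.integral_exp_sum_walsh_le_of_isLacunary hμ hδ h hq hL hM b m).trans ?_)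
        gcongr
    _ = 2 * μ Set.univ * ENNReal.ofReal (Real.exp (y ^ 2 / 4)) := by
        rw [ENNReal.ofReal_mul (by positivity), ENNReal.ofReal_mul (by norm_num),
          ENNReal.ofReal_ofNat, ofReal_measureReal]

section Quantile

variable {E : Set ℝ}

lemma monotone_rhoE : Monotone (rhoE E) := fun _ _ h =>
  div_le_div_of_nonneg_right (measureReal_mono (Set.inter_subset_inter_right _
    (Set.Icc_subset_Icc_right h)) (measure_inter_ne_top_of_right_ne_top measure_Icc_lt_top.ne))
    measureReal_nonneg

lemma rhoE_le_one (hE : E ⊆ Set.Icc 0 1) (x : ℝ) : rhoE E x ≤ 1 :=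
  div_le_one_of_le₀ (measureReal_mono Set.inter_subset_left
    (measure_ne_top_of_subset hE measure_Icc_lt_top.ne)) measureReal_nonneg

lemma rhoE_one (hE : E ⊆ Set.Icc 0 1) (h0 : 0 < volume.real E) : rhoE E 1 = 1 := by
  rw [rhoE, Set.inter_eq_left.2 hE, div_self h0.ne']

lemma continuous_rhoE : Continuous (rhoE E) := by
  have hlip : LipschitzWith 1 fun x => volume.real (E ∩ Set.Icc 0 x) := by
    refine LipschitzWith.of_le_add fun x y => ?_
    have hsub : E ∩ Set.Icc 0 x ⊆ (E ∩ Set.Icc 0 y) ∪ Set.Icc y x := by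
      rintro z ⟨hz, hz0, hzx⟩
      exact (le_total z y).imp (fun h => ⟨hz, hz0, h⟩) fun h => ⟨h, hzx⟩
    calc volume.real (E ∩ Set.Icc 0 x)
        ≤ volume.real ((E ∩ Set.Icc 0 y) ∪ Set.Icc y x) :=
          measureReal_mono hsub (measure_union_ne_top
            (measure_inter_ne_top_of_right_ne_top measure_Icc_lt_top.ne) measure_Icc_lt_top.ne)
      _ ≤ volume.real (E ∩ Set.Icc 0 y) + volume.real (Set.Icc y x) := measureReal_union_le _ _
      _ ≤ volume.real (E ∩ Set.Icc 0 y) + dist x y := by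
          rw [Real.volume_real_Icc, Real.dist_eq]
          gcongr
          exact max_le (le_abs_self _) (abs_nonneg _)
  exact hlip.continuous.div_const _

lemma rhoEInv_mem (hE : E ⊆ Set.Icc 0 1) (h0 : 0 < volume.real E) {t : ℝ} (ht : t ≤ 1) :
    rhoEInv E t ∈ Set.Icc (0 : ℝ) 1 ∧ t ≤ rhoE E (rhoEInv E t) := by
  have hclosed : IsClosed {x | x ∈ Set.Icc (0 : ℝ) 1 ∧ t ≤ rhoE E x} :=
    isClosed_Icc.inter (isClosed_le continuous_const continuous_rhoE)
  exact hclosed.csInf_mem ⟨1, by simp, by rwa [rhoE_one hE h0]⟩ ⟨0, fun x hx => hx.1.1⟩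

lemma rhoEInv_le_iff (hE : E ⊆ Set.Icc 0 1) (h0 : 0 < volume.real E) {t x : ℝ} (ht : t ≤ 1)
    (hx : 0 ≤ x) : rhoEInv E t ≤ x ↔ t ≤ rhoE E x := by
  obtain ⟨hmem, hle⟩ := rhoEInv_mem hE h0 ht
  refine ⟨fun h => hle.trans (monotone_rhoE h), fun h => ?_⟩
  rcases le_total x 1 with hx1 | hx1
  · exact csInf_le ⟨0, fun x hx => hx.1.1⟩ ⟨⟨hx, hx1⟩, h⟩
  · exact hmem.2.trans hx1

lemma rhoEInv_of_one_lt (hE : E ⊆ Set.Icc 0 1) {t : ℝ} (ht : 1 < t) : rhoEInv E t = 0 := by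
  have hempty : {x | x ∈ Set.Icc (0 : ℝ) 1 ∧ t ≤ rhoE E x} = ∅ :=
    Set.eq_empty_of_forall_notMem fun x hx => (hx.2.trans (rhoE_le_one hE x)).not_gt ht
  rw [rhoEInv, hempty, Real.sInf_empty]

-- The part `Ioi 1` is where `rhoEInv` is the infimum of the empty set, that is `0`.
lemma rhoEInv_preimage_Iic (hE : E ⊆ Set.Icc 0 1) (h0 : 0 < volume.real E) {x : ℝ} (hx : 0 ≤ x) :
    rhoEInv E ⁻¹' Set.Iic x = Set.Iic (rhoE E x) ∪ Set.Ioi 1 := by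
  ext t
  simp only [Set.mem_preimage, Set.mem_Iic, Set.mem_union, Set.mem_Ioi]
  rcases le_or_gt t 1 with ht | ht
  · simp [rhoEInv_le_iff hE h0 ht hx, ht.not_gt]
  · simp [rhoEInv_of_one_lt hE ht, hx, ht]

lemma rhoEInv_preimage_Iic_of_neg {x : ℝ} (hx : x < 0) : rhoEInv E ⁻¹' Set.Iic x = ∅ :=
  Set.eq_empty_of_forall_notMem fun _ ht =>
    (hx.trans_le (Real.sInf_nonneg fun _ hy => hy.1.1)).not_ge ht

lemma measurable_rhoEInv (hE : E ⊆ Set.Icc 0 1) (h0 : 0 < volume.real E) :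
    Measurable (rhoEInv E) := by
  refine measurable_of_Iic fun x => ?_
  rcases le_or_gt 0 x with hx | hx
  · rw [rhoEInv_preimage_Iic hE h0 hx]
    exact measurableSet_Iic.union measurableSet_Ioi
  · rw [rhoEInv_preimage_Iic_of_neg hx]
    exact MeasurableSet.empty

lemma map_rhoEInv (hE : E ⊆ Set.Icc 0 1) (h0 : 0 < volume.real E) :
    Measure.map (rhoEInv E) unitMeasure = (volume E)⁻¹ • volume.restrict E := by
  have hfin : volume E ≠ ∞ := measure_ne_top_of_subset hE measure_Icc_lt_top.ne
  refine Measure.ext_of_Iic _ _ fun x => ?_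
  rw [Measure.map_apply (measurable_rhoEInv hE h0) measurableSet_Iic, Measure.smul_apply,
    Measure.restrict_apply measurableSet_Iic]
  rcases le_or_gt 0 x with hx | hx
  · have hpre : (Set.Iic (rhoE E x) ∪ Set.Ioi 1) ∩ Set.Icc 0 1 = Set.Icc 0 (rhoE E x) := by
      have := rhoE_le_one hE x
      grind
    have hcut : Set.Iic x ∩ E = E ∩ Set.Icc 0 x := by
      ext t
      exact ⟨fun h => ⟨h.2, (hE h.2).1, h.1⟩, fun h => ⟨h.2.2, h.1⟩⟩
    rw [rhoEInv_preimage_Iic hE h0 hx, unitMeasure,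
      Measure.restrict_apply (measurableSet_Iic.union measurableSet_Ioi), hpre, hcut,
      Real.volume_Icc, sub_zero, rhoE, ENNReal.ofReal_div_of_pos h0, ofReal_measureReal hfin,
      ofReal_measureReal (measure_ne_top_of_subset Set.inter_subset_left hfin), smul_eq_mul,
      ENNReal.div_eq_inv_mul]
  · have hcut : Set.Iic x ∩ E = ∅ :=
      Set.eq_empty_of_forall_notMem fun t ht => (ht.1.trans_lt hx).not_ge (hE ht.2).1
    simp [rhoEInv_preimage_Iic_of_neg hx, hcut]

lemma lintegral_comp_rhoEInv_le_one_iff (hE : E ⊆ Set.Icc 0 1) (h0 : 0 < volume.real E)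
    {g : ℝ → ℝ≥0∞} (hg : Measurable g) :
    ∫⁻ t, g (rhoEInv E t) ∂unitMeasure ≤ 1 ↔ ∫⁻ t in E, g t ≤ volume E := by
  obtain ⟨hne, hfin⟩ := ENNReal.toReal_pos_iff.1 h0
  rw [← lintegral_map hg (measurable_rhoEInv hE h0), map_rhoEInv hE h0, lintegral_smul_measure,
    smul_eq_mul, ← ENNReal.div_eq_inv_mul, ENNReal.div_le_iff hne.ne' hfin.ne, one_mul]

variable {Φ f : ℝ → ℝ}

lemma localNorm_orliczNorm (hE : E ⊆ Set.Icc 0 1) (h0 : 0 < volume.real E) (hΦ : Measurable Φ)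
    (hf : Measurable f) :
    localNorm (orliczNorm Φ) E f
      = ⨅ (c : ℝ) (_ : 0 < c ∧ ∫⁻ t in E, ENNReal.ofReal (Φ (|f t| / c)) ≤ volume E),
        ENNReal.ofReal c :=
  iInf_congr fun _ => iInf_congr_Prop (and_congr_right' (lintegral_comp_rhoEInv_le_one_iff hE h0
    (hΦ.comp (hf.abs.div_const _)).ennreal_ofReal)) fun _ => rfl

lemma ofReal_le_localNorm_orliczNorm (hE : E ⊆ Set.Icc 0 1) (h0 : 0 < volume.real E)
    (hΦ : Measurable Φ) (hΦ2 : ∀ x, x ^ 2 ≤ Φ x) (hf : Measurable f) {s : ℝ}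
    (h : s ^ 2 * volume.real E ≤ ∫ t in E, f t ^ 2) :
    ENNReal.ofReal s ≤ localNorm (orliczNorm Φ) E f := by
  rw [localNorm_orliczNorm hE h0 hΦ hf]
  refine le_iInf₂ fun c ⟨hc, hle⟩ => ENNReal.ofReal_le_ofReal (le_of_sq_le_sq ?_ hc.le)
  have hpoint (t : ℝ) : f t ^ 2 ≤ c ^ 2 * Φ (|f t| / c) :=
    calc f t ^ 2 = c ^ 2 * (|f t| / c) ^ 2 := by
          rw [div_pow, sq_abs]
          field_simp
      _ ≤ c ^ 2 * Φ (|f t| / c) := by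
          gcongr
          exact hΦ2 _
  have hint : ∫⁻ t in E, ENNReal.ofReal (f t ^ 2) ≤ ENNReal.ofReal (c ^ 2 * volume.real E) :=
    calc ∫⁻ t in E, ENNReal.ofReal (f t ^ 2)
        ≤ ∫⁻ t in E, ENNReal.ofReal (c ^ 2) * ENNReal.ofReal (Φ (|f t| / c)) :=
          lintegral_mono fun t => by
            rw [← ENNReal.ofReal_mul (sq_nonneg c)]
            exact ENNReal.ofReal_le_ofReal (hpoint t)
      _ = ENNReal.ofReal (c ^ 2) * ∫⁻ t in E, ENNReal.ofReal (Φ (|f t| / c)) :=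
          lintegral_const_mul' _ _ ENNReal.ofReal_ne_top
      _ ≤ ENNReal.ofReal (c ^ 2 * volume.real E) := by
          rw [ENNReal.ofReal_mul (sq_nonneg c),
            ofReal_measureReal (measure_ne_top_of_subset hE measure_Icc_lt_top.ne)]
          gcongr
  rw [integral_eq_lintegral_of_nonneg_ae (Filter.Eventually.of_forall fun t => sq_nonneg _)
    (hf.pow_const 2).aestronglyMeasurable] at h
  exact le_of_mul_le_mul_right
    (h.trans (ENNReal.toReal_le_of_le_ofReal (by positivity) hint)) h0

end Quantile

section Limit

variable {Ω : Type*} [MeasurableSpace Ω] {ν : Measure Ω}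

lemma tendsto_setIntegral_sq_of_tendsto_Lp {g : ℕ → Lp ℝ 2 ν} {f : Lp ℝ 2 ν}
    (hg : Filter.Tendsto g Filter.atTop (nhds f)) (E : Set Ω) :
    Filter.Tendsto (fun m => ∫ t in E, g m t ^ 2 ∂ν) Filter.atTop
      (nhds (∫ t in E, f t ^ 2 ∂ν)) := by
  have hnorm (u : Lp ℝ 2 ν) :
      ‖LpToLpRestrictCLM Ω ℝ ℝ ν 2 E u‖ ^ 2 = ∫ t in E, u t ^ 2 ∂ν := by
    rw [← real_inner_self_eq_norm_sq, L2.inner_def]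
    refine integral_congr_ae ?_
    filter_upwards [LpToLpRestrictCLM_coeFn ℝ E u] with t ht
    simp [ht, sq]
  simpa only [Function.comp_def, hnorm] using
    (((LpToLpRestrictCLM Ω ℝ ℝ ν 2 E).continuous.tendsto f).comp hg).norm.pow 2

lemma lintegral_comp_le_of_tendsto_Lp {F : Type*} [NormedAddCommGroup F] {p : ℝ≥0∞}
    [Fact (1 ≤ p)] {μ : Measure Ω} (hμ : μ ≪ ν) {g : ℕ → Lp F p ν} {f : Lp F p ν}
    (hg : Filter.Tendsto g Filter.atTop (nhds f)) {φ : F → ℝ≥0∞} (hφ : Continuous φ) {C : ℝ≥0∞}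
    (h : ∀ m, ∫⁻ t, φ (g m t) ∂μ ≤ C) : ∫⁻ t, φ (f t) ∂μ ≤ C := by
  obtain ⟨ns, -, hns⟩ := (tendstoInMeasure_of_tendsto_Lp hg).exists_seq_tendsto_ae
  calc ∫⁻ t, φ (f t) ∂μ = ∫⁻ t, Filter.liminf (fun i => φ (g (ns i) t)) Filter.atTop ∂μ := by
        refine lintegral_congr_ae ?_
        filter_upwards [hμ.ae_le hns] with t ht using ((hφ.tendsto _).comp ht).liminf_eq.symm
    _ ≤ Filter.liminf (fun i => ∫⁻ t, φ (g (ns i) t) ∂μ) Filter.atTop :=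
        lintegral_liminf_le' fun i => (hφ.comp_aestronglyMeasurable
          ((Lp.aestronglyMeasurable (g (ns i))).mono_ac hμ)).aemeasurable
    _ ≤ C := Filter.liminf_le_of_le (by isBoundedDefault) fun b hb => by
        obtain ⟨i, hi⟩ := hb.exists
        exact hi.trans (h _)

end Limit

section Series

variable {E : Set ℝ} {q δ : ℝ} {L M : ℕ} {n : ℕ → ℕ} {a : ℕ → ℝ} {f : Lp ℝ 2 unitMeasure}

lemma summable_smul_walshLp {ι : Type*} {n : ι → ℕ} (hn : Function.Injective n) {a : ι → ℝ}
    (ha : Summable fun k => a k ^ 2) : Summable fun k => a k • walshLp (n k) := by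
  have h := (orthonormal_walshLp.comp n hn).orthogonalFamily.summable_iff_norm_sq_summable a
  simp only [LinearIsometry.toSpanSingleton_apply, Real.norm_eq_abs, sq_abs] at h
  exact h.2 ha

lemma coeFn_sum_smul_walshLp {ι : Type*} (n : ι → ℕ) (a : ι → ℝ) (S : Finset ι) :
    ⇑(∑ k ∈ S, a k • walshLp (n k)) =ᵐ[unitMeasure] fun t => ∑ k ∈ S, a k * walsh (n k) t := by
  have hterm : ∀ᵐ t ∂unitMeasure, ∀ k ∈ S, (a k • walshLp (n k)) t = a k * walsh (n k) t := by
    refine (Filter.eventually_all_finset S).2 fun k _ => ?_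
    filter_upwards [Lp.coeFn_smul (a k) (walshLp (n k)), (memLp_walsh (n k)).coeFn_toLp]
      with t hsmul hw
    rw [hsmul, Pi.smul_apply, walshLp, hw, smul_eq_mul]
  filter_upwards [Lp.coeFn_fun_finsetSum S fun k => a k • walshLp (n k), hterm] with t hsum ht
  rw [hsum, Finset.sum_congr rfl ht]

lemma restrict_unitMeasure (hE : E ⊆ Set.Icc 0 1) :
    unitMeasure.restrict E = volume.restrict E :=
  Measure.restrict_restrict_of_subset hE

lemma continuous_youngM2 : Continuous youngM2 := by
  unfold youngM2
  fun_prop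

lemma sq_le_youngM2 (x : ℝ) : x ^ 2 ≤ youngM2 x :=
  le_sub_iff_add_le.2 (Real.add_one_le_exp _)

lemma WalshTailLE.ofReal_half_mul_sqrt_le_localNorm (hE : E ⊆ Set.Icc 0 1)
    (h0 : 0 < volume.real E) (hc : WalshTailLE (volume.restrict E) L δ)
    (hδ : 8 * (M * δ) ≤ volume.real E ^ 2) (h : IsLacunary q n) (hq : 1 < q)
    (hL : ∀ k, L * q ≤ (q - 1) * n k) (hM : 2 * q ≤ (q - 1) * q ^ M)
    (ha : Summable fun k => a k ^ 2) (hf : HasSum (fun k => a k • walshLp (n k)) f) :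
    ENNReal.ofReal (1 / 2 * √(∑' k, a k ^ 2)) ≤ localNorm (orliczNorm youngM2) E f := by
  have : IsFiniteMeasure (volume.restrict E) :=
    isFiniteMeasure_restrict.2 (measure_ne_top_of_subset hE measure_Icc_lt_top.ne)
  have hpartial (m : ℕ) : volume.real E / 2 * ∑ k ∈ Finset.range m, a k ^ 2
      ≤ ∫ t in E, (∑ k ∈ Finset.range m, a k • walshLp (n k) : Lp ℝ 2 unitMeasure) t ^ 2
        ∂unitMeasure := by
    rw [← measureReal_restrict_apply_univ] at hδ ⊢
    refine (hc.half_mul_sum_sq_le_integral Measure.absolutelyContinuous_restrict h hq hL hM hδ a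
      m).trans_eq ?_
    rw [← restrict_unitMeasure hE]
    refine integral_congr_ae ?_
    filter_upwards [ae_restrict_of_ae (coeFn_sum_smul_walshLp n a (Finset.range m))] with t ht
    rw [ht]
  have hsum := le_of_tendsto_of_tendsto' (ha.hasSum.tendsto_sum_nat.const_mul _)
    (tendsto_setIntegral_sq_of_tendsto_Lp hf.tendsto_sum_nat E) hpartial
  rw [restrict_unitMeasure hE] at hsum
  refine ofReal_le_localNorm_orliczNorm hE h0 continuous_youngM2.measurable sq_le_youngM2
    (Lp.stronglyMeasurable f).measurable (le_trans ?_ hsum)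
  have hσ : 0 ≤ ∑' k, a k ^ 2 := tsum_nonneg fun k => sq_nonneg _
  rw [mul_pow, Real.sq_sqrt hσ]
  linarith [mul_nonneg h0.le hσ]

lemma WalshTailLE.lintegral_youngM2_tsum_le (hE : E ⊆ Set.Icc 0 1)
    (hc : WalshTailLE (volume.restrict E) L δ) (hδ : δ ≤ volume.real E ^ 2) (h : IsLacunary q n)
    (hq : 1 < q) (hL : ∀ k, 2 * L ≤ n k) (hM : 3 ≤ q ^ M) (ha : Summable fun k => a k ^ 2)
    (hf : HasSum (fun k => a k • walshLp (n k)) f) {s : ℝ} (hs : 0 < s)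
    (hσ : M ^ 2 * ∑' k, a k ^ 2 ≤ s ^ 2) :
    ∫⁻ t in E, ENNReal.ofReal (youngM2 (|f t| / (4 * s))) ≤ volume E := by
  have : IsFiniteMeasure (volume.restrict E) :=
    isFiniteMeasure_restrict.2 (measure_ne_top_of_subset hE measure_Icc_lt_top.ne)
  have hcont : Continuous fun x : ℝ => ENNReal.ofReal (youngM2 (|x| / (4 * s))) :=
    ENNReal.continuous_ofReal.comp (continuous_youngM2.comp (continuous_abs.div_const _))
  have hac : volume.restrict E ≪ unitMeasure :=
    Measure.absolutelyContinuous_of_le (Measure.restrict_mono_set volume hE)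
  refine lintegral_comp_le_of_tendsto_Lp hac hf.tendsto_sum_nat hcont fun m => ?_
  have hσm : M ^ 2 * ∑ k ∈ Finset.range m, a k ^ 2 ≤ s ^ 2 := by
    refine le_trans ?_ hσ
    gcongr
    exact ha.sum_le_tsum _ fun k _ => sq_nonneg _
  rw [← measureReal_restrict_apply_univ] at hδ
  have hpartial := hc.lintegral_youngM2_sum_le Measure.absolutelyContinuous_restrict hδ h hq hL hM
    hs hσm
  rw [Measure.restrict_apply_univ] at hpartial
  refine (lintegral_congr_ae ?_).trans_le hpartial
  filter_upwards [hac.ae_le (coeFn_sum_smul_walshLp n a (Finset.range m))] with t ht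
  rw [ht]

lemma WalshTailLE.localNorm_le_ofReal_mul_sqrt (hE : E ⊆ Set.Icc 0 1)
    (h0 : 0 < volume.real E) (hc : WalshTailLE (volume.restrict E) L δ)
    (hδ : δ ≤ volume.real E ^ 2) (h : IsLacunary q n) (hq : 1 < q)
    (hL : ∀ k, 2 * L ≤ n k) (hM : 3 ≤ q ^ M)
    (ha : Summable fun k => a k ^ 2) (hf : HasSum (fun k => a k • walshLp (n k)) f) :
    localNorm (orliczNorm youngM2) E f ≤ ENNReal.ofReal (4 * M * √(∑' k, a k ^ 2)) := by
  rw [mul_assoc]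
  set s₀ := M * √(∑' k, a k ^ 2) with hs₀
  have hsq : M ^ 2 * ∑' k, a k ^ 2 = s₀ ^ 2 := by
    rw [hs₀, mul_pow, Real.sq_sqrt (tsum_nonneg fun k => sq_nonneg _)]
  have hbound : ∀ s ∈ Set.Ioi s₀, localNorm (orliczNorm youngM2) E f ≤ ENNReal.ofReal (4 * s) := by
    intro s hs
    have hs₀_nonneg : 0 ≤ s₀ := by positivity
    have hs_pos : 0 < s := hs₀_nonneg.trans_lt hs
    rw [localNorm_orliczNorm hE h0 continuous_youngM2.measurable
      (Lp.stronglyMeasurable f).measurable]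
    refine iInf₂_le _ ⟨by positivity, hc.lintegral_youngM2_tsum_le hE hδ h hq hL hM ha hf hs_pos ?_⟩
    exact hsq.trans_le (pow_le_pow_left₀ hs₀_nonneg (Set.mem_Ioi.1 hs).le 2)
  have hcont : Continuous fun s : ℝ => ENNReal.ofReal (4 * s) :=
    ENNReal.continuous_ofReal.comp (continuous_const_mul 4)
  exact ge_of_tendsto (hcont.continuousWithinAt (s := Set.Ioi s₀))
    (eventually_mem_nhdsWithin.mono hbound)

end Series

theorem theorem3p1_general (q : ℝ) (hq : 1 < q) :
    ∃ A B : ℝ, 0 < A ∧ 0 < B ∧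
      ∀ E : Set ℝ, E ⊆ Set.Icc 0 1 → 0 < volume E →
        ∃ N : ℕ, ∀ n : ℕ → ℕ, IsLacunary q n → (∀ k, N ≤ n k) →
          ∀ a : ℕ → ℝ, Summable (fun k => a k ^ 2) →
            ∃ f : Lp ℝ 2 unitMeasure, HasSum (fun k => a k • walshLp (n k)) f ∧
              ENNReal.ofReal (A * √(∑' k, a k ^ 2)) ≤ localNorm (orliczNorm youngM2) E f ∧
              localNorm (orliczNorm youngM2) E f ≤ ENNReal.ofReal (B * √(∑' k, a k ^ 2)) := by
  have hq1 : 0 < q - 1 := sub_pos.2 hq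
  obtain ⟨M, hM⟩ := pow_unbounded_of_one_lt (3 * q / (q - 1)) hq
  rw [div_lt_iff₀' hq1] at hM
  have hM3 : 3 ≤ q ^ M := by nlinarith
  have hM0 : M ≠ 0 := by
    rintro rfl
    norm_num at hM3
  have hM1 : (1 : ℝ) ≤ M := Nat.one_le_cast.2 (Nat.one_le_iff_ne_zero.2 hM0)
  refine ⟨1 / 2, 4 * M, by norm_num, by positivity, fun E hE hpos => ?_⟩
  have h0 : 0 < volume.real E :=
    ENNReal.toReal_pos hpos.ne' (measure_ne_top_of_subset hE measure_Icc_lt_top.ne)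
  set δ := volume.real E ^ 2 / (8 * M) with hδ
  have hδ8 : 8 * (M * δ) ≤ volume.real E ^ 2 := le_of_eq (by rw [hδ]; field_simp)
  have hδ1 : δ ≤ volume.real E ^ 2 := div_le_self (sq_nonneg _) (by linarith)
  obtain ⟨L, hL⟩ := exists_walshTailLE (Measure.restrict_mono_set volume hE)
    (show 0 < δ by positivity)
  refine ⟨⌈2 * L * q / (q - 1)⌉₊, fun n hn hN a ha => ?_⟩
  have hNq (k : ℕ) : 2 * L * q ≤ (q - 1) * n k := (div_le_iff₀' hq1).1 (Nat.ceil_le.1 (hN k))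
  have hLq (k : ℕ) : L * q ≤ (q - 1) * n k := by linarith [hNq k, (by positivity : 0 ≤ L * q)]
  have hL2 (k : ℕ) : 2 * L ≤ n k := by
    exact_mod_cast (by nlinarith [hNq k, (L.cast_nonneg : (0 : ℝ) ≤ L)] : (2 * L : ℝ) ≤ n k)
  obtain ⟨f, hf⟩ := summable_smul_walshLp (hn.strictMono hq).injective ha
  exact ⟨f, hf,
    hL.ofReal_half_mul_sqrt_le_localNorm hE h0 hδ8 hn hq hLq (by linarith) ha hf,
    hL.localNorm_le_ofReal_mul_sqrt hE h0 hδ1 hn hq hL2 hM3 ha hf⟩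

theorem theorem3p1 (q : ℝ) (hq : 1 < q) :
    ∃ A B : ℝ, 0 < A ∧ 0 < B ∧
      ∀ E : Set ℝ, E ⊆ Set.Icc 0 1 → NullMeasurableSet E volume → 0 < volume E →
        ∃ N : ℕ, ∀ n : ℕ → ℕ, IsLacunary q n → (∀ k, N ≤ n k) →
          ∀ a : ℕ → ℝ, Summable (fun k => a k ^ 2) →
            ∃ f : Lp ℝ 2 unitMeasure, HasSum (fun k => a k • walshLp (n k)) f ∧
              ENNReal.ofReal (A * √(∑' k, a k ^ 2)) ≤ localNorm (orliczNorm youngM2) E f ∧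
              localNorm (orliczNorm youngM2) E f ≤ ENNReal.ofReal (B * √(∑' k, a k ^ 2)) := by
  obtain ⟨A, B, hA, hB, h⟩ := theorem3p1_general q hq
  exact ⟨A, B, hA, hB, fun E hE _ hpos => h E hE hpos⟩
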